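/- Let $\mathcal G=(\mathcal V,\mathcal E)$ be a finite directed graph without self-loops, and let $\mathcal R,\mathcal C\subseteq\mathcal V$ be the sets of excited and of measured vertices. Call a rational function in $\mathbb R(q)$ proper if the degree of its numerator is at most that of its denominator, and stable if all its poles lie in the open unit disc. Let $\{G(q,\theta):\theta\in\Theta\}$ be a parametrization of all matrices $G\in\mathbb R(q)^{\mathcal V\times\mathcal V}$ such that * $G_{ji}\neq 0$ if and only if $(i,j)\in\mathcal E$, * all entries of $G$ are proper and stable, * $I-G$ is invertible and all entries of $(I-G)^{-1}$ are proper and stable. Let $R$ and $C$ be the matrices consisting of the columns of the identity indexed by $\mathcal R$ and of its rows indexed by $\mathcal C$, and put $M(q,\theta)=(G(q,\theta),R,C)$ and $T(q,\theta)=(I-G(q,\theta))^{-1}$. The model set $\mathcal M=\{M(q,\theta):\theta\in\Theta\}$ is called identifiable if for all $\theta_0,\theta_1\in\Theta$ $$C\,T(q,\theta_1)R=C\,T(q,\theta_0)R\ \Longrightarrow\ M(q,\theta_1)=M(q,\theta_0).$$ Now regard the modules $G_{ji}$, $(i,j)\in\mathcal E$, as independent indeterminates, so that $T=(I-G)^{-1}$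 becomes a matrix of rational functions in these indeterminates over $\mathbb R$, and let $$\mathscr F=\{T_{\ell k}:\ \ell\in\mathcal C,\ k\in\mathcal R,\ T_{\ell k}\neq 0,\ T_{\ell k}\neq 1\}$$ be the set of nonconstant entries of $T_{\mathcal C,\mathcal R}$. The structural rank $\mathrm{Sprank}(A)$ of a matrix $A$ is the highest rank of all real matrices with the same nonzero pattern as $A$. Suppose that $|\mathcal R|=1$ or $|\mathcal C|=1$. Then: 1. (No elimination is needed.) There are no $\bar{\mathcal C}\subseteq\mathcal C$ and $\bar{\mathcal R}\subseteq\mathcal R$ with $\mathrm{Rank}(T_{\bar{\mathcal C},\bar{\mathcal R}})<\mathrm{Sprank}(T_{\bar{\mathcal C},\bar{\mathcal R}})=|\bar{\mathcal C}|=|\bar{\mathcal R}|$. 2. If $\mathcal M$ is identifiable, then $|\mathscr F|\ge|\mathcal E|$. -/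

import Mathlib

/-- A simple directed graph on the vertex set `V`: `(i, j) ∈ edges` is the edge from `i` to `j`,
and there are no self-loops. -/
structure SimpleDigraph (V : Type*) where
  edges : Finset (V × V)
  loopless : ∀ i, (i, i) ∉ edges

namespace DynNet

noncomputable section

/-- A transfer function is proper if the degree of its numerator does not exceed that of its
denominator. -/
def IsProper (f : RatFunc ℝ) : Prop :=
  f.num.natDegree ≤ f.denom.natDegree

/-- A (discrete-time) transfer function in the shift operator `q` is stable if all its poles lie
in the open unit disc.  The denominator is the reduced one. -/
def IsStable (f : RatFunc ℝ) : Prop :=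
  ∀ z : ℂ, Polynomial.aeval z f.denom = 0 → ‖z‖ < 1

variable {V : Type*} [Fintype V] [DecidableEq V]

/-- The transfer matrix `T = (I - G)⁻¹`, over any field. -/
def transfer {K : Type*} [Field K] (G : Matrix V V K) : Matrix V V K :=
  (1 - G)⁻¹

/-- The standing assumptions on a network matrix `G(q)` with topology `𝓖`: the entry `G_{ji}` is
nonzero exactly when `(i, j)` is an edge, all entries of `G` are proper and stable, and the network
is well-posed and stable, i.e. `(I - G)⁻¹` exists and is proper and stable. -/
structure IsAdmissible (𝓖 : SimpleDigraph V) (G : Matrix V V (RatFunc ℝ)) : Prop where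
  support : ∀ i j, G j i ≠ 0 ↔ (i, j) ∈ 𝓖.edges
  proper : ∀ i j, IsProper (G i j)
  stable : ∀ i j, IsStable (G i j)
  invertible : IsUnit (1 - G)
  transfer_proper : ∀ i j, IsProper (transfer G i j)
  transfer_stable : ∀ i j, IsStable (transfer G i j)

/-- A network model `M = (G, R, C)`. The columns of `R` and the rows of `C` are indexed by the
sets of excited and of measured vertices. -/
structure Model (V : Type*) (exc mea : Finset V) where
  G : Matrix V V (RatFunc ℝ)
  R : Matrix V exc (RatFunc ℝ)
  C : Matrix mea V (RatFunc ℝ)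

/-- The binary matrix consisting of the columns of the identity indexed by the excited vertices. -/
def excitationMatrix (exc : Finset V) : Matrix V exc (RatFunc ℝ) :=
  (1 : Matrix V V (RatFunc ℝ)).submatrix id Subtype.val

/-- The binary matrix consisting of the rows of the identity indexed by the measured vertices. -/
def measurementMatrix (mea : Finset V) : Matrix mea V (RatFunc ℝ) :=
  (1 : Matrix V V (RatFunc ℝ)).submatrix Subtype.val id

/-- The model `M(q, θ) = (G(q, θ), R, C)`. -/
def model (exc mea : Finset V) {Θ : Type*} (G : Θ → Matrix V V (RatFunc ℝ)) (θ : Θ) :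
    Model V exc mea :=
  ⟨G θ, excitationMatrix exc, measurementMatrix mea⟩

/-- The map `C T R` from the excitations to the measurements. -/
def Model.response {exc mea : Finset V} (M : Model V exc mea) : Matrix mea exc (RatFunc ℝ) :=
  M.C * transfer M.G * M.R

/-- The modules of the network are parametrized independently and without any restriction besides
the standing assumptions: as `θ` runs through `Θ`, the matrix `G(q, θ)` runs through all admissible
network matrices with topology `𝓖`. -/
def IsParametrization (𝓖 : SimpleDigraph V) {Θ : Type*} (G : Θ → Matrix V V (RatFunc ℝ)) : Prop :=
  Set.range G = {G' | IsAdmissible 𝓖 G'}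

/-- Identifiability of the model set `{M(q, θ) | θ ∈ Θ}` from `T_{C,R}` at `M(q, θ₀)`. -/
def IdentifiableAt (exc mea : Finset V) {Θ : Type*} (G : Θ → Matrix V V (RatFunc ℝ))
    (θ₀ : Θ) : Prop :=
  ∀ θ₁ : Θ, (model exc mea G θ₁).response = (model exc mea G θ₀).response →
    model exc mea G θ₁ = model exc mea G θ₀

/-- Identifiability of the model set `{M(q, θ) | θ ∈ Θ}` from `T_{C,R}`. -/
def Identifiable (exc mea : Finset V) {Θ : Type*} (G : Θ → Matrix V V (RatFunc ℝ)) : Prop :=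
  ∀ θ₀ : Θ, IdentifiableAt exc mea G θ₀

/-- The field of rational functions in the unknown modules, one indeterminate per edge. -/
abbrev ModuleField (𝓖 : SimpleDigraph V) : Type _ :=
  FractionRing (MvPolynomial 𝓖.edges ℝ)

/-- The network matrix whose nonzero entries are the indeterminates. -/
def genericG (𝓖 : SimpleDigraph V) : Matrix V V (ModuleField 𝓖) :=
  Matrix.of fun j i =>
    if h : (i, j) ∈ 𝓖.edges then
      algebraMap (MvPolynomial 𝓖.edges ℝ) (ModuleField 𝓖) (MvPolynomial.X ⟨(i, j), h⟩)
    else 0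

/-- The transfer matrix `T` as a matrix of rational functions in the unknown modules. -/
def genericT (𝓖 : SimpleDigraph V) : Matrix V V (ModuleField 𝓖) :=
  transfer (genericG 𝓖)

/-- The inverse defining `genericT` is a genuine one. -/
theorem isUnit_one_sub_genericG (𝓖 : SimpleDigraph V) : IsUnit (1 - genericG 𝓖) := by
  classical
  rw [Matrix.isUnit_iff_isUnit_det, isUnit_iff_ne_zero]
  let P : Matrix V V (MvPolynomial 𝓖.edges ℝ) := Matrix.of fun j i =>
    if h : (i, j) ∈ 𝓖.edges then MvPolynomial.X ⟨(i, j), h⟩ else 0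
  have hP : 1 - genericG 𝓖 =
      (algebraMap (MvPolynomial 𝓖.edges ℝ) (ModuleField 𝓖)).mapMatrix (1 - P) := by
    rw [map_sub, map_one]
    congr 1
    ext j i
    by_cases h : (i, j) ∈ 𝓖.edges <;> simp [genericG, P, h]
  rw [hP, ← RingHom.map_det]
  intro h0
  have h1 : (1 - P).det = 0 :=
    (IsFractionRing.injective (MvPolynomial 𝓖.edges ℝ) (ModuleField 𝓖)) (by rw [h0, map_zero])
  have h2 : MvPolynomial.constantCoeff (1 - P).det = 1 := by
    rw [RingHom.map_det, map_sub, map_one]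
    have : (MvPolynomial.constantCoeff (R := ℝ) (σ := 𝓖.edges)).mapMatrix P = 0 := by
      ext j i
      by_cases h : (i, j) ∈ 𝓖.edges <;> simp [P, h]
    rw [this, sub_zero, Matrix.det_one]
  rw [h1, map_zero] at h2
  exact zero_ne_one h2

/-- The set `𝓕` of nonconstant elements of `T_{C,R}`: the entries, as rational functions in the
unknown modules, that are neither `0` nor `1`. -/
def nonconstantEntries (𝓖 : SimpleDigraph V) (exc mea : Finset V) : Set (ModuleField 𝓖) :=
  {f | ∃ l ∈ mea, ∃ k ∈ exc, f = genericT 𝓖 l k ∧ genericT 𝓖 l k ≠ 0 ∧ genericT 𝓖 l k ≠ 1}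

theorem nonconstantEntries_finite (𝓖 : SimpleDigraph V) (exc mea : Finset V) :
    (nonconstantEntries 𝓖 exc mea).Finite := by
  refine (Set.finite_range fun p : V × V => genericT 𝓖 p.1 p.2).subset ?_
  rintro f ⟨l, -, k, -, rfl, -⟩
  exact ⟨(l, k), rfl⟩

/-- The submatrix of `T` with rows in `mea` and columns in `exc`. -/
def subT (𝓖 : SimpleDigraph V) (mea exc : Finset V) : Matrix mea exc (ModuleField 𝓖) :=
  (genericT 𝓖).submatrix Subtype.val Subtype.val

/-- The structural rank: the highest rank of all real matrices with the same nonzero pattern. -/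
def sprank {m n K : Type*} [Fintype n] [Field K] (A : Matrix m n K) : ℕ :=
  sSup {r | ∃ B : Matrix m n ℝ, (∀ i j, B i j = 0 ↔ A i j = 0) ∧ B.rank = r}

/-- The subsets `mea'` of the measured and `exc'` of the excited vertices trigger an elimination of
a dependent entry: `Rank T_{mea',exc'} < Sprank T_{mea',exc'} = |mea'| = |exc'|`. -/
def TriggersElimination (𝓖 : SimpleDigraph V) (mea' exc' : Finset V) : Prop :=
  (subT 𝓖 mea' exc').rank < sprank (subT 𝓖 mea' exc') ∧
    sprank (subT 𝓖 mea' exc') = mea'.card ∧ mea'.card = exc'.card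

end

end DynNet

/-! For the first claim, a square submatrix of `T_{C,R}` has size at most 1, and rank below
structural rank would force it to be zero; the zero pattern has structural rank 0. For the second,
nonzero real constants with `det (1 - G) ≠ 0` are admissible modules and form a nonempty open set in
`ℝ^E`. Identifiability makes the map from these constants to the values of `T_{C,R}` injective.
Entries equal to 0 or 1 carry no information and equal entries take equal values, so the functions
in `𝓕` already separate points. They are C¹, so `finrank_le_of_locally_separating` gives `|E| ≤
|𝓕|`; it replaces invariance of domain by induction on the number of functions. -/

/-! ### Dimension bound for separating C¹ functions -/

open Filter Topology in
/-- The implicit function theorem for a scalar function: near a regular point, the level set of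
`f` is parametrized injectively and smoothly by the kernel of the derivative. -/
theorem exists_contDiffAt_levelSet_param {E : Type*} [NormedAddCommGroup E] [NormedSpace ℝ E]
    [FiniteDimensional ℝ E] {f : E → ℝ} {a : E} (hf : ContDiffAt ℝ 1 f a)
    (ha : fderiv ℝ f a ≠ 0) :
    ∃ (g : (fderiv ℝ f a).ker → E) (y₀ : (fderiv ℝ f a).ker), g y₀ = a ∧ ContDiffAt ℝ 1 g y₀ ∧
      ∃ t ∈ 𝓝 y₀, Set.InjOn g t ∧ ∀ y ∈ t, f (g y) = f a := by
  have hs : HasStrictFDerivAt f (fderiv ℝ f a) a := hf.hasStrictFDerivAt one_ne_zero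
  have hr : (fderiv ℝ f a).range = ⊤ := by
    apply LinearMap.range_eq_top.mpr
    apply LinearMap.surjective
    intro h
    exact ha (ContinuousLinearMap.coe_injective h)
  have hk := (fderiv ℝ f a).ker_closedComplemented_of_finiteDimensional_range
  let φ := hs.implicitFunctionDataOfComplemented f (fderiv ℝ f a) hr hk
  have hl : ContDiffAt ℝ 1 φ.leftFun φ.pt := hf
  have hR : ContDiffAt ℝ 1 φ.rightFun φ.pt := by
    -- The second coordinate is a continuous linear projection onto the kernel, applied to `x - a`.
    change ContDiffAt ℝ 1 (fun x => Classical.choose hk (x - a)) a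
    fun_prop
  have hc := φ.contDiffAt_implicitFunction hl hR one_ne_zero
  have ht : ContDiffAt ℝ 1 (fun y : (fderiv ℝ f a).ker => (φ.leftFun φ.pt, y))
      (φ.rightFun φ.pt) := by fun_prop
  have hev : ∀ᶠ y in 𝓝 (φ.rightFun φ.pt),
      φ.prodFun (φ.implicitFunction (φ.leftFun φ.pt) y) = (φ.leftFun φ.pt, y) :=
    ht.continuousAt.eventually φ.prodFun_implicitFunction
  refine ⟨fun y => φ.implicitFunction (φ.leftFun φ.pt) y, φ.rightFun φ.pt,
    φ.implicitFunction_apply_image.self_of_nhds,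
    ContDiffAt.comp (g := φ.implicitFunction.uncurry) (φ.rightFun φ.pt) hc ht,
    _, hev, ?_, ?_⟩
  · intro y hy z hz hyz
    have h1 := congrArg φ.prodFun hyz
    exact (Prod.ext_iff.mp ((hy.symm.trans h1).trans hz)).2
  · intro y hy
    exact (Prod.ext_iff.mp hy).1

open Filter Topology in
/-- A space on which `m` continuously differentiable functions separate the points of some open set
has dimension at most `m`. -/
theorem finrank_le_of_locally_separating {E : Type*} [NormedAddCommGroup E] [NormedSpace ℝ E]
    [FiniteDimensional ℝ E] {m : ℕ} {f : Fin m → E → ℝ} {a : E}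
    (hf : ∀ i, ContDiffAt ℝ 1 (f i) a) {s : Set E} (hs : s ∈ 𝓝 a)
    (hinj : ∀ x ∈ s, ∀ y ∈ s, (∀ i, f i x = f i y) → x = y) : Module.finrank ℝ E ≤ m := by
  induction m generalizing E with
  | zero =>
    by_contra! h
    have : Nontrivial E := Module.nontrivial_of_finrank_pos h
    obtain ⟨x, hx, hxa⟩ := ((frequently_iff.mp
      (eventually_mem_nhdsWithin.frequently : ∃ᶠ x in 𝓝[≠] a, x ∈ ({a}ᶜ : Set E)))
        (mem_nhdsWithin_of_mem_nhds hs))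
    exact hxa (hinj x hx a (mem_of_mem_nhds hs) fun i => i.elim0)
  | succ m ih =>
    have hev : ∀ᶠ x in 𝓝 a, ∀ i, ContDiffAt ℝ 1 (f i) x :=
      eventually_all.mpr fun i => (hf i).eventually (by simp)
    -- Either `f 0` is constant near `a` and separates nothing, or its derivative is nonzero at some
    -- `b` near `a`. In the latter case the other functions separate points on the level set of `f
    -- 0` through `b`, which has one dimension less.
    by_cases hz : ∀ᶠ x in 𝓝 a, fderiv ℝ (f 0) x = 0
    · obtain ⟨r, hr, hball⟩ := Metric.eventually_nhds_iff_ball.mp (hz.and hev)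
      refine (ih (f := fun i => f i.succ) (fun i => hf _)
        (inter_mem hs (Metric.ball_mem_nhds a hr)) ?_).trans m.le_succ
      rintro x ⟨hxs, hx⟩ y ⟨hys, hy⟩ hxy
      refine hinj x hxs y hys (Fin.cases ?_ hxy)
      refine Metric.isOpen_ball.is_const_of_fderiv_eq_zero (𝕜 := ℝ)
        (convex_ball a r).isPreconnected (fun z hz => ?_) (fun z hz => (hball z hz).1) hx hy
      exact (((hball z hz).2 0).differentiableAt one_ne_zero).differentiableWithinAt
    · obtain ⟨b, hb, hbd, hbs⟩ := (not_eventually.mp hz).and_eventually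
        (hev.and (eventually_mem_nhds_iff.mpr hs)) |>.exists
      obtain ⟨g, y₀, hg, hgc, t, ht, hgi, hgt⟩ := exists_contDiffAt_levelSet_param (hbd 0) hb
      have hker : Module.finrank ℝ (fderiv ℝ (f 0) b).ker ≤ m := by
        refine ih (f := fun i => f i.succ ∘ g) (fun i => ?_)
          (inter_mem ht (hgc.continuousAt.preimage_mem_nhds (hg.symm ▸ hbs))) ?_
        · exact ContDiffAt.comp y₀ (hg.symm ▸ hbd i.succ) hgc
        · rintro x ⟨hxt, hxs⟩ y ⟨hyt, hys⟩ hxy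
          refine hgi hxt hyt (hinj _ hxs _ hys (Fin.cases ?_ hxy))
          rw [hgt x hxt, hgt y hyt]
      have h1 := LinearMap.finrank_range_add_finrank_ker (fderiv ℝ (f 0) b : E →ₗ[ℝ] ℝ)
      have h2 := Submodule.finrank_le (LinearMap.range (fderiv ℝ (f 0) b : E →ₗ[ℝ] ℝ))
      rw [Module.finrank_self] at h2
      change _ + Module.finrank ℝ (fderiv ℝ (f 0) b).ker = _ at h1
      omega

/-! ### Structural rank of submatrices of size at most one -/

namespace DynNet

/-- Only the zero matrix has rank 0, and it is the only real matrix with its pattern. -/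
theorem sprank_eq_zero_of_rank_eq_zero {m n K : Type*} [Fintype m] [Fintype n] [Field K]
    {A : Matrix m n K} (h : A.rank = 0) : sprank A = 0 := by
  classical
  have hA : A = 0 := by
    rw [Matrix.rank, Submodule.finrank_eq_zero, LinearMap.range_eq_bot] at h
    exact Matrix.toLin'.injective (h.trans (map_zero _).symm)
  subst hA
  refine Nat.eq_zero_of_le_zero (csSup_le' ?_)
  rintro r ⟨B, hB, rfl⟩
  have hB0 : B = 0 := Matrix.ext fun i j => (hB i j).mpr rfl
  simp [hB0]

/-- Sets of excited and measured vertices of which one is a singleton trigger no elimination. -/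
theorem not_triggersElimination {V : Type*} [Fintype V] [DecidableEq V] (𝓖 : SimpleDigraph V)
    {mea exc : Finset V} (h : exc.card ≤ 1 ∨ mea.card ≤ 1) : ¬ TriggersElimination 𝓖 mea exc := by
  rintro ⟨h1, h2, h3⟩
  have h0 : (subT 𝓖 mea exc).rank = 0 := by omega
  have := sprank_eq_zero_of_rank_eq_zero h0
  omega

/-! ### Entries of the transfer matrix as polynomial quotients -/

/-- Cramer's rule, with adjugate and determinant taken before applying `φ`, serves both the generic
matrix and its evaluations. If `φ` kills the determinant, both sides are 0 by convention. -/
theorem transfer_mapMatrix {V : Type*} [Fintype V] [DecidableEq V] {A K : Type*} [CommRing A]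
    [Field K] (φ : A →+* K) (P : Matrix V V A) (l k : V) :
    transfer (φ.mapMatrix P) l k = φ ((1 - P).adjugate l k) / φ (1 - P).det := by
  have h : 1 - φ.mapMatrix P = φ.mapMatrix (1 - P) := by rw [map_sub, map_one]
  rw [transfer, h, Matrix.inv_def, ← RingHom.map_det, ← RingHom.map_adjugate,
    Ring.inverse_eq_inv', Matrix.smul_apply, smul_eq_mul, mul_comm, div_eq_mul_inv]
  rfl

theorem response_model_apply {V : Type*} [Fintype V] [DecidableEq V] {exc mea : Finset V}
    {Θ : Type*} (G : Θ → Matrix V V (RatFunc ℝ)) (θ : Θ) (l : mea) (k : exc) :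
    (model exc mea G θ).response l k = transfer (G θ) l k := by
  simp [Model.response, model, measurementMatrix, excitationMatrix, Matrix.mul_apply,
    Matrix.one_apply]

theorem isProper_C (c : ℝ) : IsProper (RatFunc.C c) := by
  simp [IsProper]

theorem isStable_C (c : ℝ) : IsStable (RatFunc.C c) := by
  intro z hz
  simp at hz

variable {V : Type*} [Fintype V] [DecidableEq V] (𝓖 : SimpleDigraph V)

/-- The network matrix with one indeterminate per edge, as a matrix of polynomials. -/
noncomputable def polyG : Matrix V V (MvPolynomial 𝓖.edges ℝ) :=
  Matrix.of fun j i => if h : (i, j) ∈ 𝓖.edges then MvPolynomial.X ⟨(i, j), h⟩ else 0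

theorem genericG_eq_mapMatrix_polyG :
    genericG 𝓖 = (algebraMap (MvPolynomial 𝓖.edges ℝ) (ModuleField 𝓖)).mapMatrix (polyG 𝓖) := by
  ext j i
  by_cases h : (i, j) ∈ 𝓖.edges <;> simp [genericG, polyG, h]

theorem det_one_sub_polyG_ne_zero : (1 - polyG 𝓖).det ≠ 0 := by
  intro h
  have hu := (Matrix.isUnit_iff_isUnit_det _).mp (isUnit_one_sub_genericG 𝓖)
  have h1 : 1 - genericG 𝓖 =
      (algebraMap (MvPolynomial 𝓖.edges ℝ) (ModuleField 𝓖)).mapMatrix (1 - polyG 𝓖) := by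
    rw [map_sub, map_one, genericG_eq_mapMatrix_polyG]
  rw [h1, ← RingHom.map_det, h, map_zero] at hu
  exact not_isUnit_zero hu

theorem genericT_apply (l k : V) :
    genericT 𝓖 l k = algebraMap (MvPolynomial 𝓖.edges ℝ) (ModuleField 𝓖)
        ((1 - polyG 𝓖).adjugate l k) /
      algebraMap (MvPolynomial 𝓖.edges ℝ) (ModuleField 𝓖) (1 - polyG 𝓖).det := by
  rw [genericT, genericG_eq_mapMatrix_polyG, transfer_mapMatrix]

theorem algebraMap_det_one_sub_polyG_ne_zero :
    algebraMap (MvPolynomial 𝓖.edges ℝ) (ModuleField 𝓖) (1 - polyG 𝓖).det ≠ 0 := by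
  rw [Ne, IsFractionRing.to_map_eq_zero_iff]
  exact det_one_sub_polyG_ne_zero 𝓖

theorem genericT_eq_zero_iff (l k : V) :
    genericT 𝓖 l k = 0 ↔ (1 - polyG 𝓖).adjugate l k = 0 := by
  rw [genericT_apply, div_eq_zero_iff, or_iff_left (algebraMap_det_one_sub_polyG_ne_zero 𝓖),
    IsFractionRing.to_map_eq_zero_iff]

theorem genericT_eq_one_iff (l k : V) :
    genericT 𝓖 l k = 1 ↔ (1 - polyG 𝓖).adjugate l k = (1 - polyG 𝓖).det := by
  rw [genericT_apply, div_eq_one_iff_eq (algebraMap_det_one_sub_polyG_ne_zero 𝓖),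
    (IsFractionRing.injective (MvPolynomial 𝓖.edges ℝ) (ModuleField 𝓖)).eq_iff]

/-- The common denominator cancels, leaving a polynomial identity that can be evaluated at any
point. -/
theorem genericT_eq_iff (l k l' k' : V) : genericT 𝓖 l k = genericT 𝓖 l' k' ↔
    (1 - polyG 𝓖).adjugate l k = (1 - polyG 𝓖).adjugate l' k' := by
  rw [genericT_apply, genericT_apply, div_left_inj' (algebraMap_det_one_sub_polyG_ne_zero 𝓖),
    (IsFractionRing.injective (MvPolynomial 𝓖.edges ℝ) (ModuleField 𝓖)).eq_iff]

/-! ### Networks with constant modules -/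

/-- The network matrix whose modules are the constants `x`. -/
noncomputable def constG (x : 𝓖.edges → ℝ) : Matrix V V (RatFunc ℝ) :=
  ((RatFunc.C).comp (MvPolynomial.eval x)).mapMatrix (polyG 𝓖)

/-- The value of `T_{lk}` at constant modules `x`. -/
noncomputable def evalT (l k : V) (x : 𝓖.edges → ℝ) : ℝ :=
  MvPolynomial.eval x ((1 - polyG 𝓖).adjugate l k) / MvPolynomial.eval x (1 - polyG 𝓖).det

/-- The nonzero constant modules at which the network is well-posed. -/
def regularPoints : Set (𝓖.edges → ℝ) :=
  {x | (∀ e, x e ≠ 0) ∧ MvPolynomial.eval x (1 - polyG 𝓖).det ≠ 0}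

theorem constG_apply (x : 𝓖.edges → ℝ) (j i : V) :
    constG 𝓖 x j i = RatFunc.C (if h : (i, j) ∈ 𝓖.edges then x ⟨(i, j), h⟩ else 0) := by
  by_cases h : (i, j) ∈ 𝓖.edges <;> simp [constG, polyG, h]

theorem constG_injective : Function.Injective (constG 𝓖) := by
  rintro x y hxy
  ext ⟨⟨i, j⟩, h⟩
  have := congrFun (congrFun hxy j) i
  rw [constG_apply, constG_apply, dif_pos h, dif_pos h] at this
  exact RatFunc.C.injective this

theorem transfer_constG_apply (x : 𝓖.edges → ℝ) (l k : V) :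
    transfer (constG 𝓖 x) l k = RatFunc.C (evalT 𝓖 l k x) := by
  rw [constG, transfer_mapMatrix, evalT, map_div₀]
  rfl

/-- Constants have no poles and degree 0, and the transfer matrix of a constant network is again
constant. -/
theorem isAdmissible_constG {x : 𝓖.edges → ℝ} (hx : x ∈ regularPoints 𝓖) :
    IsAdmissible 𝓖 (constG 𝓖 x) where
  support i j := by
    rw [constG_apply, map_ne_zero]
    by_cases h : (i, j) ∈ 𝓖.edges <;> simp [h, hx.1]
  proper i j := constG_apply 𝓖 x i j ▸ isProper_C _
  stable i j := constG_apply 𝓖 x i j ▸ isStable_C _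
  invertible := by
    have h : 1 - constG 𝓖 x =
        ((RatFunc.C).comp (MvPolynomial.eval x)).mapMatrix (1 - polyG 𝓖) := by
      rw [map_sub, map_one, constG]
    rw [Matrix.isUnit_iff_isUnit_det, isUnit_iff_ne_zero, h, ← RingHom.map_det, RingHom.comp_apply,
      map_ne_zero]
    exact hx.2
  transfer_proper i j := transfer_constG_apply 𝓖 x i j ▸ isProper_C _
  transfer_stable i j := transfer_constG_apply 𝓖 x i j ▸ isStable_C _

theorem isOpen_regularPoints : IsOpen (regularPoints 𝓖) := by
  refine IsOpen.inter (isOpen_iff_mem_nhds.mpr fun x hx => ?_)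
    (isOpen_ne_fun (MvPolynomial.continuous_eval _) continuous_const)
  exact Filter.eventually_all.mpr fun e => (continuous_apply e).continuousAt.eventually_ne (hx e)

/-- The product of all indeterminates and the determinant is a nonzero polynomial, so it is nonzero
at some real point. -/
theorem regularPoints_nonempty : (regularPoints 𝓖).Nonempty := by
  have hne : (∏ e, MvPolynomial.X e) * (1 - polyG 𝓖).det ≠ 0 :=
    mul_ne_zero (Finset.prod_ne_zero_iff.mpr fun e _ => MvPolynomial.X_ne_zero e)
      (det_one_sub_polyG_ne_zero 𝓖)
  obtain ⟨x, hx⟩ : ∃ x, MvPolynomial.eval x ((∏ e, MvPolynomial.X e) * (1 - polyG 𝓖).det) ≠ 0 := by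
    by_contra! h
    exact hne (MvPolynomial.funext fun x => by rw [h x, map_zero])
  rw [map_mul, map_prod, mul_ne_zero_iff, Finset.prod_ne_zero_iff] at hx
  exact ⟨x, fun e => by simpa using hx.1 e (Finset.mem_univ e), hx.2⟩

theorem contDiff_eval {σ : Type*} [Fintype σ] (p : MvPolynomial σ ℝ) :
    ContDiff ℝ 1 fun x : σ → ℝ => MvPolynomial.eval x p := by
  induction p using MvPolynomial.induction_on with
  | C a => simpa using contDiff_const
  | add p q hp hq => simpa using hp.add hq
  | mul_X p i hp => simpa using hp.mul (contDiff_apply ℝ ℝ i)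

theorem contDiffAt_evalT (l k : V) {x : 𝓖.edges → ℝ} (hx : x ∈ regularPoints 𝓖) :
    ContDiffAt ℝ 1 (evalT 𝓖 l k) x :=
  (contDiff_eval _).contDiffAt.div (contDiff_eval _).contDiffAt hx.2

/-- The values of the nonconstant entries of `T_{C,R}` determine those of all entries. -/
theorem evalT_eq_of_nonconstantEntries {exc mea : Finset V} {x y : 𝓖.edges → ℝ}
    (hx : x ∈ regularPoints 𝓖) (hy : y ∈ regularPoints 𝓖) {l' k' : nonconstantEntries 𝓖 exc mea → V}
    (hlk : ∀ f, genericT 𝓖 (l' f) (k' f) = f)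
    (h : ∀ f, evalT 𝓖 (l' f) (k' f) x = evalT 𝓖 (l' f) (k' f) y)
    {l k : V} (hl : l ∈ mea) (hk : k ∈ exc) : evalT 𝓖 l k x = evalT 𝓖 l k y := by
  by_cases h0 : genericT 𝓖 l k = 0
  · rw [genericT_eq_zero_iff] at h0
    simp [evalT, h0]
  by_cases h1 : genericT 𝓖 l k = 1
  · rw [genericT_eq_one_iff] at h1
    rw [evalT, evalT, h1, div_self hx.2, div_self hy.2]
  have hf := h ⟨genericT 𝓖 l k, l, hl, k, hk, rfl, h0, h1⟩
  have he := (genericT_eq_iff 𝓖 _ _ _ _).mp (hlk ⟨genericT 𝓖 l k, l, hl, k, hk, rfl, h0, h1⟩)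
  rwa [evalT, evalT, he] at hf

/-- Identifiability needs at least as many nonconstant entries of `T_{C,R}` as there are modules. -/
theorem card_edges_le_ncard_nonconstantEntries {exc mea : Finset V} {Θ : Type*}
    {G : Θ → Matrix V V (RatFunc ℝ)} (hG : IsParametrization 𝓖 G) (hid : Identifiable exc mea G) :
    𝓖.edges.card ≤ (nonconstantEntries 𝓖 exc mea).ncard := by
  have := (nonconstantEntries_finite 𝓖 exc mea).fintype
  -- One position is chosen per element of `𝓕`, so an entry occurring at several positions counts
  -- once.
  choose l' hl' k' hk' hlk h0 h1 using fun f : nonconstantEntries 𝓖 exc mea => f.2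
  obtain ⟨a, ha⟩ := regularPoints_nonempty 𝓖
  let e := Fintype.equivFin (nonconstantEntries 𝓖 exc mea)
  have key := finrank_le_of_locally_separating
    (f := fun i => evalT 𝓖 (l' (e.symm i)) (k' (e.symm i)))
    (fun i => contDiffAt_evalT 𝓖 _ _ ha) ((isOpen_regularPoints 𝓖).mem_nhds ha) ?_
  · rwa [Module.finrank_fintype_fun_eq_card, Fintype.card_coe, ← Nat.card_eq_fintype_card,
      Nat.card_coe_set_eq] at key
  · intro x hx y hy hxy
    obtain ⟨θx, hθx⟩ : constG 𝓖 x ∈ Set.range G := hG ▸ isAdmissible_constG 𝓖 hx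
    obtain ⟨θy, hθy⟩ : constG 𝓖 y ∈ Set.range G := hG ▸ isAdmissible_constG 𝓖 hy
    refine constG_injective 𝓖 ?_
    rw [← hθx, ← hθy]
    refine congrArg Model.G (hid θy θx ?_)
    ext l k
    rw [response_model_apply, response_model_apply, hθx, hθy, transfer_constG_apply,
      transfer_constG_apply, evalT_eq_of_nonconstantEntries 𝓖 hx hy (fun f => (hlk f).symm)
        (fun f => by simpa using hxy (e f)) l.2 k.2]

end DynNet

theorem mainTheorem6 {V : Type*} [Fintype V] [DecidableEq V] (𝓖 : SimpleDigraph V)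
    (exc mea : Finset V) (hcard : exc.card = 1 ∨ mea.card = 1)
    {Θ : Type*} (G : Θ → Matrix V V (RatFunc ℝ)) (hG : DynNet.IsParametrization 𝓖 G) :
    (∀ mea' ⊆ mea, ∀ exc' ⊆ exc, ¬ DynNet.TriggersElimination 𝓖 mea' exc') ∧
    (DynNet.Identifiable exc mea G →
      𝓖.edges.card ≤ (DynNet.nonconstantEntries 𝓖 exc mea).ncard) := by
  refine ⟨fun mea' hm exc' he => DynNet.not_triggersElimination 𝓖 ?_,
    DynNet.card_edges_le_ncard_nonconstantEntries 𝓖 hG⟩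
  exact hcard.imp ((Finset.card_le_card he).trans_eq ·) ((Finset.card_le_card hm).trans_eq ·)
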